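/- **Definitions.** A \emph{2-identity} is a pair $\mathbf s=(a,e)$ where $a=\mathrm{Dom}_{\mathbf s}$ is a finite set and $e=e_{\mathbf s}$ is an equivalence relation on $[a]^2$, the set of two-element subsets of $a$. $\mathrm{ID}_2(\aleph_1,\aleph_0)$ is the set of 2-identities $(n,e)$ with $n=\{0,\dots,n-1\}$, $n<\omega$, such that for every $f:[\omega_1]^{<\aleph_0}\to\omega$ there is a one-to-one $g:n\to\omega_1$ such that $b\,e\,c$ implies $f(g''(b))=f(g''(c))$. For $k<\omega$ let $\mathbf s_k$ be the 2-identity with domain $k+\binom k2$ in which every equivalence class is a singleton, except for the two classes $$\bigl\{\{\ell_0,\,k+\tbinom{\ell_1}2+\ell_0\}:\ell_0<\ell_1<k\bigr\}\quad\text{and}\quad\bigl\{\{\ell_1,\,k+\tbinom{\ell_1}2+\ell_0\}:\ell_0<\ell_1<k\bigr\}$$ (for $k\le 2$ each of these two sets has at most one element). **Statement.** (1) and (2): If $\mathbf s=(n,e)\in\mathrm{ID}_2(\aleph_1,\aleph_0)$, then there are a linear order $<$ of $\mathrm{Dom}_{\mathbf s}=n$ and a function $h:[n]^2/e\to\omega$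 (we write $h(\{\ell_0,\ell_1\})$ for the value of $h$ at the class of $\{\ell_0,\ell_1\}$) such that for every $e$-equivalence class $\mathbf a$ there are sets $a_0,a_1$ with: (i) $a_0,a_1$ are disjoint finite subsets of $\mathrm{Dom}_{\mathbf s}$; (ii) if $\{\ell_0,\ell_1\}\in\mathbf a$ and $\ell_0<\ell_1$, then $\ell_0\in a_0$ and $\ell_1\in a_1$; (iii) if $\ell_0\neq\ell_1$ are from $a_0\cup a_1$ and $\{\ell_0,\ell_1\}\notin\mathbf a$, then $h(\{\ell_0,\ell_1\})>h(\mathbf a)$; and moreover, for the same order and the same $h$: (iv) if $\mathbf a_0,\mathbf a_1$ are distinct $e$-equivalence classes, then for some $m\in\{0,1\}$ the set $[\bigcup\mathbf a_m]^2\setminus\mathbf a_m$ is disjoint from $\mathbf a_{1-m}$; (v) for every class $\mathbf a$, (i)–(iii) hold with $a_0=\{\ell_0:\{\ell_0,\ell_1\}\in\mathbf a,\ \ell_0<\ell_1\text{ for some }\ell_1\}$ and $a_1=\{\ell_1:\{\ell_0,\ell_1\}\in\mathbf a,\ \ell_0<\ell_1\text{ for some }\ell_0\}$. (3) If $k\ge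 3$, then $\mathbf s_k$ does not satisfy (iv), and $\mathbf s_k\notin\mathrm{ID}_2(\aleph_1,\aleph_0)$. -/

import Mathlib

open Cardinal

namespace TwoId

universe u v

/-- A partial identity on the set `α` (finite in all uses): an equivalence relation `rel` on a
subfamily of the finite subsets of `α`, relating only sets of the same size.  The subfamily is
`{b | rel b b}`, so an equivalence relation on it is a symmetric and transitive relation. -/
structure PartialIdentity (α : Type u) where
  rel : Finset α → Finset α → Prop
  symm : ∀ {b c}, rel b c → rel c b
  trans : ∀ {b c d}, rel b c → rel c d → rel b d
  card_eq : ∀ {b c}, rel b c → b.card = c.card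

/-- The partition relation `κ → (α, e)_μ`: for every `f : [κ]^{<ℵ₀} → μ` there is a one-to-one
`h : α → κ` such that `b e c` implies `f (h '' b) = f (h '' c)`.  A cardinal is identified with
the set of ordinals below its initial ordinal. -/
def Arrow {α : Type u} (κ μ : Cardinal.{v}) (p : PartialIdentity α) : Prop :=
  ∀ f : Finset (Set.Iio κ.ord) → Set.Iio μ.ord,
    ∃ h : α ↪ Set.Iio κ.ord, ∀ b c : Finset α, p.rel b c → f (b.map h) = f (c.map h)

/-- `[α]²`, the set of two-element subsets of `α`. -/
abbrev Pair (α : Type u) : Type u := {b : Finset α // b.card = 2}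

/-- The pair `{x, y}` of two distinct points. -/
def mkPair {α : Type u} [DecidableEq α] (x y : α) (hxy : x ≠ y) : Pair α :=
  ⟨{x, y}, Finset.card_pair hxy⟩

/-- `[A]²` for a subset `A` of `α`. -/
def pairsIn {α : Type u} (A : Set α) : Set (Pair α) := {b | (b.1 : Set α) ⊆ A}

/-- A 2-identity with domain `α`: an equivalence relation on `[α]²`. -/
structure TwoIdentity (α : Type u) where
  e : Setoid (Pair α)

namespace TwoIdentity

variable {α : Type u}

/-- The partial identity `(α, e⁺)`, where `b e⁺ c` means that `b e c` or `b = c`. -/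
def plus (s : TwoIdentity α) : PartialIdentity α where
  rel b c := (∃ (hb : b.card = 2) (hc : c.card = 2), s.e.r ⟨b, hb⟩ ⟨c, hc⟩) ∨ b = c
  symm := by
    rintro b c (⟨hb, hc, h⟩ | rfl)
    · exact Or.inl ⟨hc, hb, s.e.symm h⟩
    · exact Or.inr rfl
  trans := by
    rintro b c d (⟨hb, hc, h⟩ | rfl) (⟨hc', hd, h'⟩ | rfl)
    · exact Or.inl ⟨hb, hd, s.e.trans h h'⟩
    · exact Or.inl ⟨hb, hc, h⟩
    · exact Or.inl ⟨hc', hd, h'⟩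
    · exact Or.inr rfl
  card_eq := by
    rintro b c (⟨hb, hc, -⟩ | rfl)
    · rw [hb, hc]
    · rfl

/-- The set `[α]²/e` of equivalence classes. -/
abbrev Class (s : TwoIdentity α) : Type u := Quotient s.e

variable {s : TwoIdentity α}

/-- An equivalence class as a set of pairs. -/
def members (a : s.Class) : Set (Pair α) := {b | (Quotient.mk s.e b) = a}

/-- `⋃ a`, the set of all points occurring in a pair of the class `a`. -/
def support (a : s.Class) : Set α := {x | ∃ b ∈ members a, x ∈ b.1}

/-- The smaller endpoints of the pairs of `a`, with respect to the order `lt`. -/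
def lower [DecidableEq α] (lt : α → α → Prop) (a : s.Class) : Set α :=
  {x | ∃ (y : α) (hxy : x ≠ y), mkPair x y hxy ∈ members a ∧ lt x y}

/-- The larger endpoints of the pairs of `a`, with respect to the order `lt`. -/
def upper [DecidableEq α] (lt : α → α → Prop) (a : s.Class) : Set α :=
  {y | ∃ (x : α) (hxy : x ≠ y), mkPair x y hxy ∈ members a ∧ lt x y}

/-- Clauses (i), (ii), (iii) for the class `a` and the sets `a₀`, `a₁`. -/
def Separates [DecidableEq α] (lt : α → α → Prop) (h : s.Class → ℕ) (a : s.Class)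
    (a₀ a₁ : Set α) : Prop :=
  (a₀.Finite ∧ a₁.Finite ∧ Disjoint a₀ a₁) ∧
  (∀ (x y : α) (hxy : x ≠ y), mkPair x y hxy ∈ members a → lt x y → x ∈ a₀ ∧ y ∈ a₁) ∧
  (∀ (x y : α) (hxy : x ≠ y), x ∈ a₀ ∪ a₁ → y ∈ a₀ ∪ a₁ → mkPair x y hxy ∉ members a →
    h a < h (Quotient.mk s.e (mkPair x y hxy)))

/-- The one-sided disjointness criterion: of any two distinct classes, one, say `a`, is such
that `[⋃ a]² \ a` is disjoint from the other. -/
def OneSided (s : TwoIdentity α) : Prop :=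
  ∀ a b : s.Class, a ≠ b →
    Disjoint (pairsIn (support a) \ members a) (members b) ∨
    Disjoint (pairsIn (support b) \ members b) (members a)

end TwoIdentity

/-- `ID₂(κ, μ)`: the 2-identities `(n, e)` with domain `n = {0, …, n - 1}` and
`κ → (n, e)_μ`. -/
def ID₂ (κ μ : Cardinal.{v}) : Set (Σ n : ℕ, TwoIdentity (Fin n)) :=
  {s | Arrow κ μ s.2.plus}

/-- The pairs `{ℓ₀, k + C(ℓ₁,2) + ℓ₀}` for `ℓ₀ < ℓ₁ < k`. -/
def lowClass (k : ℕ) : Set (Pair (Fin (k + k.choose 2))) :=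
  {b | ∃ l₀ l₁ : ℕ, l₀ < l₁ ∧ l₁ < k ∧
    b.1.map Fin.valEmbedding = {l₀, k + l₁.choose 2 + l₀}}

/-- The pairs `{ℓ₁, k + C(ℓ₁,2) + ℓ₀}` for `ℓ₀ < ℓ₁ < k`. -/
def highClass (k : ℕ) : Set (Pair (Fin (k + k.choose 2))) :=
  {b | ∃ l₀ l₁ : ℕ, l₀ < l₁ ∧ l₁ < k ∧
    b.1.map Fin.valEmbedding = {l₁, k + l₁.choose 2 + l₀}}

theorem choose_two_add_lt {l₀ l₁ m : ℕ} (h₀ : l₀ < l₁) (h : l₁ < m) :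
    l₁.choose 2 + l₀ < m.choose 2 := by
  have h1 : (l₁ + 1).choose 2 = l₁ + l₁.choose 2 := by
    rw [Nat.choose_succ_succ' l₁ 1, Nat.choose_one_right]
  have h2 : (l₁ + 1).choose 2 ≤ m.choose 2 := Nat.choose_le_choose 2 h
  omega

theorem code_inj {l₀ l₁ m₀ m₁ : ℕ} (h : l₀ < l₁) (h' : m₀ < m₁)
    (he : l₁.choose 2 + l₀ = m₁.choose 2 + m₀) : l₀ = m₀ ∧ l₁ = m₁ := by
  rcases lt_trichotomy l₁ m₁ with hl | hl | hl
  · have := choose_two_add_lt h hl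
    omega
  · subst hl
    exact ⟨by omega, rfl⟩
  · have := choose_two_add_lt h' hl
    omega

theorem not_mem_highClass {k : ℕ} {b : Pair (Fin (k + k.choose 2))} (hb : b ∈ lowClass k) :
    b ∉ highClass k := by
  rintro ⟨m₀, m₁, hm, hmk, h'⟩
  obtain ⟨l₀, l₁, hl, hlk, h⟩ := hb
  rw [h] at h'
  have h1 : l₀ ∈ ({m₁, k + m₁.choose 2 + m₀} : Finset ℕ) := h' ▸ by simp
  have h2 : k + l₁.choose 2 + l₀ ∈ ({m₁, k + m₁.choose 2 + m₀} : Finset ℕ) := h' ▸ by simp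
  simp only [Finset.mem_insert, Finset.mem_singleton] at h1 h2
  have h3 : l₁.choose 2 + l₀ = m₁.choose 2 + m₀ := by omega
  obtain ⟨h4, h5⟩ := code_inj hl hm h3
  omega

/-- The 2-identity `s_k` with domain `k + C(k,2)`: every class is a singleton, except for
`lowClass k` and `highClass k`. -/
def sk (k : ℕ) : TwoIdentity (Fin (k + k.choose 2)) where
  e :=
    { r := fun b c => b = c ∨ (b ∈ lowClass k ∧ c ∈ lowClass k) ∨
        (b ∈ highClass k ∧ c ∈ highClass k)
      iseqv :=
        { refl := fun _ => Or.inl rfl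
          symm := by
            rintro b c (h | h | h)
            · exact Or.inl h.symm
            · exact Or.inr (Or.inl h.symm)
            · exact Or.inr (Or.inr h.symm)
          trans := by
            rintro b c d (rfl | h | h) (rfl | h' | h')
            · exact Or.inl rfl
            · exact Or.inr (Or.inl h')
            · exact Or.inr (Or.inr h')
            · exact Or.inr (Or.inl h)
            · exact Or.inr (Or.inl ⟨h.1, h'.2⟩)
            · exact absurd h'.1 (not_mem_highClass h.2)
            · exact Or.inr (Or.inr h)
            · exact absurd h.2 (not_mem_highClass h'.1)
            · exact Or.inr (Or.inr ⟨h.1, h'.2⟩) } }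

end TwoId

/-! It suffices to find one colouring of pairs of countable ordinals whose colour classes behave as
the classes of `s` should; an injection `g` supplied by the arrow relation then pulls back its order
and its colours. `exists_forall_isLadder` writes the order of `ω₁` as an increasing union of tree
orders `<ₙ` with finite sets of predecessors. `exists_star_coloring` colours `{α < β}` by the least
`n` with `α <ₙ β` and the `<ₙ`-heights `p < q` of `α` and `β`. Lower and upper endpoints of one
colour differ in height, so they are disjoint. If two endpoints are `<ₙ`-comparable, their heights
are `p` and `q`; a point has only one predecessor of height `p`, so the pair has that colour. All
other pairs become comparable only after `n`. Hence `h`, the first coordinate of the colour, works.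
Clause (iv) follows by comparing the two values of `h`, and `s_k` violates (iv). -/

namespace TwoId

/-! ### Tree orders exhausting the order of `ω₁`, and the colouring they define. -/

section Ladder

variable {X : Type*} [LinearOrder X]

/-- `B n` are the strict predecessors of a point `β` in the `n`-th of an increasing sequence of
tree orders with finite sets of predecessors, whose union is the given linear order; `D α n`
are the predecessors of the points `α < β`. -/
structure IsLadder (β : X) (D : ∀ α, α < β → ℕ → Set X) (B : ℕ → Set X) : Prop where
  finite : ∀ n, (B n).Finite
  mono : Monotone B
  lt : ∀ n, ∀ α ∈ B n, α < β
  exhausts : ∀ α < β, ∃ n, α ∈ B n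
  coherent : ∀ n, ∀ α (h : α < β), α ∈ B n → B n ∩ Set.Iio α = D α h n

/-- In the `n`-th tree, `β` is placed immediately above one point of a cofinal sequence in `Iio β`;
that point moves up the sequence as `n` grows. -/
theorem exists_isLadder (hX : ∀ x : X, (Set.Iio x).Countable) (β : X) (D : X → ℕ → Set X)
    (hD : ∀ α < β, IsLadder α (fun γ _ => D γ) (D α)) :
    ∃ B, IsLadder β (fun γ _ => D γ) B := by
  rcases (Set.Iio β).eq_empty_or_nonempty with he | hne
  · have hno : ∀ α, ¬ α < β := fun α hα => by
      have : α ∈ Set.Iio β := hα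
      simp [he] at this
    exact ⟨fun _ => ∅, fun _ => Set.finite_empty, fun _ _ _ => le_rfl, by simp,
      fun α hα => absurd hα (hno α), by simp⟩
  obtain ⟨a, ha⟩ := (hX β).exists_eq_range hne
  have haβ : ∀ i, a i < β := fun i => by
    have : a i ∈ Set.Iio β := ha ▸ Set.mem_range_self i
    exact this
  -- Only weakly increasing, so that a `β` with an immediate predecessor needs no separate case.
  let γ : ℕ → X := fun i => partialSups a i
  have hγβ : ∀ i, γ i < β := fun i => by
    obtain ⟨j, -, hj⟩ := exists_partialSups_eq a i
    exact (congrArg (· < β) hj).mpr (haβ j)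
  have hγmono : Monotone γ := (partialSups a).monotone
  let le : ℕ → X → X → Prop := fun n x y => x = y ∨ x ∈ D y n
  have le_mono : ∀ {m n x y}, m ≤ n → y < β → le m x y → le n x y := by
    rintro m n x y hmn hy (h | h)
    · exact Or.inl h
    · exact Or.inr ((hD y hy).mono hmn h)
  have le_trans' : ∀ {n x y z}, z < β → le n x y → le n y z → le n x z := by
    rintro n x y z hz h (rfl | h2)
    · exact h
    rcases h with rfl | h1
    · exact Or.inr h2
    · have h3 := (hD z hz).coherent n y ((hD z hz).lt n y h2) h2
      rw [← h3] at h1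
      exact Or.inr h1.1
  have le_of : ∀ {x y}, y < β → x ≤ y → ∃ n, le n x y := by
    intro x y hy hxy
    rcases hxy.eq_or_lt with h | h
    · exact ⟨0, Or.inl h⟩
    · obtain ⟨n, hn⟩ := (hD y hy).exhausts x h
      exact ⟨n, Or.inr hn⟩
  classical
  -- `γ 0, …, γ i` is a chain in the `n`-th tree. Moving along this chain keeps `B` monotone. Each
  -- `i` satisfies `P n i` for large `n`, so `idx` is unbounded and `B` exhausts `Iio β`.
  let P : ℕ → ℕ → Prop := fun n i => ∀ j < i, le n (γ j) (γ (j + 1))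
  let idx : ℕ → ℕ := fun n => Nat.findGreatest (P n) n
  have hidx : ∀ n, P n (idx n) := fun n =>
    Nat.findGreatest_spec (P := P n) (Nat.zero_le n) (fun j hj => absurd hj (Nat.not_lt_zero j))
  have hP_mono : ∀ {m n i}, m ≤ n → P m i → P n i := fun hmn h j hj =>
    le_mono hmn (hγβ _) (h j hj)
  have hidx_mono : Monotone idx := fun m n hmn =>
    Nat.le_findGreatest ((Nat.findGreatest_le m).trans hmn) (hP_mono hmn (hidx m))
  have hchain : ∀ {n i j}, i ≤ j → P n j → le n (γ i) (γ j) := by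
    intro n i j hij
    induction j, hij using Nat.le_induction with
    | base => exact fun _ => Or.inl rfl
    | succ j hij ih =>
      intro h
      exact le_trans' (hγβ _) (ih fun l hl => h l (hl.trans j.lt_succ_self)) (h j j.lt_succ_self)
  have hP_ex : ∀ i, ∃ n, P n i := by
    intro i
    induction i with
    | zero => exact ⟨0, fun j hj => absurd hj (Nat.not_lt_zero j)⟩
    | succ i ih =>
      obtain ⟨n, hn⟩ := ih
      obtain ⟨m, hm⟩ := le_of (hγβ (i + 1)) (hγmono i.le_succ)
      refine ⟨max n m, fun j hj => ?_⟩
      rcases (Nat.lt_succ_iff_lt_or_eq.mp hj) with h | rfl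
      · exact hP_mono (le_max_left n m) hn j h
      · exact le_mono (le_max_right n m) (hγβ _) hm
  refine ⟨fun n => {x | le n x (γ (idx n))}, ?_, ?_, ?_, ?_, ?_⟩
  · intro n
    exact ((hD _ (hγβ (idx n))).finite n).insert (γ (idx n))
  · intro m n hmn x hx
    exact le_trans' (hγβ _) (le_mono hmn (hγβ _) hx) (hchain (hidx_mono hmn) (hidx n))
  · rintro n α (rfl | h)
    · exact hγβ _
    · exact ((hD _ (hγβ _)).lt n α h).trans (hγβ _)
  · intro α hα
    have : α ∈ Set.range a := ha ▸ hα
    obtain ⟨i, rfl⟩ := this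
    obtain ⟨m, hm⟩ := le_of (hγβ i) (le_partialSups a i)
    obtain ⟨l, hl⟩ := hP_ex i
    let N := max m (max l i)
    have hN : P N i := hP_mono ((le_max_left l i).trans (le_max_right _ _)) hl
    have hi : i ≤ idx N := Nat.le_findGreatest ((le_max_right l i).trans (le_max_right _ _)) hN
    exact ⟨N, le_trans' (hγβ _) (le_mono (le_max_left _ _) (hγβ _) hm) (hchain hi (hidx N))⟩
  · intro n α hα h
    have hγ := hD _ (hγβ (idx n))
    rcases h with rfl | h
    · ext x
      constructor
      · rintro ⟨rfl | hx, hlt⟩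
        · exact absurd hlt (lt_irrefl _)
        · exact hx
      · exact fun hx => ⟨Or.inr hx, hγ.lt n x hx⟩
    · rw [← hγ.coherent n α (hγ.lt n α h) h]
      ext x
      constructor
      · rintro ⟨rfl | hx, hlt⟩
        · exact absurd (hγ.lt n α h) (not_lt_of_gt hlt)
        · exact ⟨hx, hlt⟩
      · exact fun hx => ⟨Or.inr hx.1, hx.2⟩

theorem exists_forall_isLadder [WellFoundedLT X] (hX : ∀ x : X, (Set.Iio x).Countable) :
    ∃ D : X → ℕ → Set X, ∀ β, IsLadder β (fun γ _ => D γ) (D β) := by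
  classical
  -- The default value is never used: the induction below shows that a ladder always exists.
  let step : ∀ β : X, (∀ α, α < β → ℕ → Set X) → ℕ → Set X := fun β D =>
    if h : ∃ B, IsLadder β D B then h.choose else fun _ => ∅
  let D : X → ℕ → Set X := (wellFounded_lt (α := X)).fix step
  have hfix : ∀ β, D β = step β fun γ _ => D γ := fun β => WellFounded.fix_eq _ step β
  refine ⟨D, fun β => ?_⟩
  induction β using (wellFounded_lt (α := X)).induction with
  | _ β ih =>
    have hex : ∃ B, IsLadder β (fun γ _ => D γ) B := exists_isLadder hX β D ih
    have h1 : D β = hex.choose := (hfix β).trans (dif_pos hex)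
    have h2 := hex.choose_spec
    rw [← h1] at h2
    exact h2

/-- A colouring of pairs all of whose colour classes are star forests with disjoint sets of
lower and upper endpoints, and such that the pairs of endpoints outside the colour class have a
larger first coordinate. -/
theorem exists_star_coloring [WellFoundedLT X] (hX : ∀ x : X, (Set.Iio x).Countable) :
    ∃ c : Finset X → ℕ × ℕ × ℕ,
      (∀ α β α' β' : X, α < β → α' < β' → c {α, β} = c {α', β'} → α ≠ β') ∧
      ∀ b b' : Finset X, b.card = 2 → b'.card = 2 → c b = c b' → ∀ u ∈ b, ∀ v ∈ b', u ≠ v →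
        (c b).1 < (c {u, v}).1 ∨ {u, v} = b ∨ {u, v} = b' := by
  classical
  obtain ⟨D, hD⟩ := exists_forall_isLadder hX
  let lev : X → X → ℕ := fun α β => sInf {n | α ∈ D β n}
  let ht : ℕ → X → ℕ := fun n α => (D α n).ncard
  have hlev : ∀ {α β}, α < β → α ∈ D β (lev α β) := fun {α β} h =>
    Nat.sInf_mem (s := {n | α ∈ D β n}) ((hD β).exhausts α h)
  have hht : ∀ {n α β}, α ∈ D β n → ht n α < ht n β := by
    intro n α β h
    refine Set.ncard_lt_ncard ?_ ((hD β).finite n)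
    rw [← (hD β).coherent n α ((hD β).lt n α h) h]
    exact ⟨Set.inter_subset_left, fun hs => lt_irrefl α (hs h).2⟩
  -- By coherence the predecessors of `β` form a chain, along which heights increase strictly.
  have huniq : ∀ {n α α' β}, α ∈ D β n → α' ∈ D β n → ht n α = ht n α' → α = α' := by
    intro n α α' β h h' he
    have key : ∀ {x y}, x ∈ D β n → y ∈ D β n → x < y → ht n x < ht n y := by
      intro x y hx hy hxy
      refine hht ?_
      rw [← (hD β).coherent n y ((hD β).lt n y hy) hy]
      exact ⟨hx, hxy⟩
    rcases lt_trichotomy α α' with hlt | heq | hlt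
    · exact absurd he (key h h' hlt).ne
    · exact heq
    · exact absurd he (key h' h hlt).ne'
  let c : Finset X → ℕ × ℕ × ℕ := fun b =>
    if h : b.Nonempty then
      (lev (b.min' h) (b.max' h), ht (lev (b.min' h) (b.max' h)) (b.min' h),
        ht (lev (b.min' h) (b.max' h)) (b.max' h))
    else 0
  have hc : ∀ {α β}, α < β → c {α, β} = (lev α β, ht (lev α β) α, ht (lev α β) β) := by
    intro α β h
    have hn : ({α, β} : Finset X).Nonempty := ⟨α, by simp⟩
    have hmin : ({α, β} : Finset X).min' hn = α := by
      rw [Finset.min'_pair]; exact min_eq_left h.le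
    have hmax : ({α, β} : Finset X).max' hn = β := by
      rw [Finset.max'_pair]; exact max_eq_right h.le
    simp only [c, dif_pos hn, hmin, hmax]
  have hpair : ∀ b : Finset X, b.card = 2 → ∃ α β, α < β ∧ b = {α, β} := by
    intro b hb
    obtain ⟨x, y, hxy, rfl⟩ := Finset.card_eq_two.mp hb
    rcases hxy.lt_or_gt with h | h
    · exact ⟨x, y, h, rfl⟩
    · exact ⟨y, x, h, Finset.pair_comm x y⟩
  refine ⟨c, ?_, ?_⟩
  · rintro α β α' _ h h' he rfl
    rw [hc h, hc h', Prod.mk.injEq, Prod.mk.injEq] at he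
    obtain ⟨h1, h2, h3⟩ := he
    have := hht (hlev h')
    rw [h1] at h2
    omega
  · have main : ∀ α β α' β' : X, α < β → α' < β' → c {α, β} = c {α', β'} →
        ∀ u ∈ ({α, β} : Finset X), ∀ v ∈ ({α', β'} : Finset X), u < v →
          (c {α, β}).1 < (c {u, v}).1 ∨ ({u, v} : Finset X) = {α', β'} := by
      intro α β α' β' h h' he u hu v hv huv
      rw [hc h, hc huv]
      rw [hc h, hc h', Prod.mk.injEq, Prod.mk.injEq] at he
      obtain ⟨h1, h2, h3⟩ := he
      refine (lt_or_ge (lev α β) (lev u v)).imp id fun hle => ?_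
      -- Now `u` lies below `v` in the tree of the common level, and both heights are among the two
      -- values of the colour; so `v = β'`, and `u` has the height of `α'`.
      have huD : u ∈ D v (lev α β) := (hD v).mono hle (hlev huv)
      have hlt := hht huD
      have hαβ := hht (hlev h)
      have hαβ' := hht (hlev h')
      have hl' := hlev h'
      rw [← h1] at h2 h3 hαβ' hl'
      simp only [Finset.mem_insert, Finset.mem_singleton] at hu hv
      rcases hv with rfl | rfl
      · rcases hu with rfl | rfl <;> omega
      rcases hu with rfl | rfl
      · rw [huniq huD hl' h2]
      · omega
    intro b b' hb hb' he u hu v hv huv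
    obtain ⟨α, β, h, rfl⟩ := hpair b hb
    obtain ⟨α', β', h', rfl⟩ := hpair b' hb'
    rcases huv.lt_or_gt with hlt | hlt
    · exact (main α β α' β' h h' he u hu v hv hlt).imp id Or.inr
    · rw [he, Finset.pair_comm u v]
      exact (main α' β' α β h' h he.symm v hv u hu hlt).imp id Or.inl

end Ladder

/-! ### Transfer of the colouring to 2-identities. -/

namespace TwoIdentity

variable {α : Type*} [DecidableEq α] {s : TwoIdentity α}

theorem exists_eq_mkPair {b : Pair α} {x y : α} (hxy : x ≠ y) (hx : x ∈ b.1) (hy : y ∈ b.1) :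
    b = mkPair x y hxy := by
  refine Subtype.ext (Finset.eq_of_subset_of_card_le ?_ ?_).symm
  · intro z hz
    rcases Finset.mem_insert.mp hz with rfl | hz
    · exact hx
    · rwa [Finset.mem_singleton.mp hz]
  · rw [b.2]
    exact (Finset.card_pair hxy).ge

theorem mkPair_comm (x y : α) (hxy : x ≠ y) : mkPair x y hxy = mkPair y x hxy.symm :=
  Subtype.ext (Finset.pair_comm x y)

theorem support_subset {lt : α → α → Prop} [IsStrictTotalOrder α lt] (a : s.Class) :
    support a ⊆ lower lt a ∪ upper lt a := by
  rintro x ⟨b, hb, hx⟩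
  obtain ⟨y, hy, hyx⟩ : ∃ y ∈ b.1, y ≠ x :=
    Finset.exists_mem_ne (by rw [b.2]; exact one_lt_two) x
  rw [exists_eq_mkPair hyx.symm hx hy] at hb
  rcases trichotomous_of lt x y with h | h | h
  · exact Or.inl ⟨y, hyx.symm, hb, h⟩
  · exact absurd h.symm hyx
  · exact Or.inr ⟨y, hyx, mkPair_comm x y hyx.symm ▸ hb, h⟩

theorem lower_union_upper_subset {lt : α → α → Prop} (a : s.Class) :
    lower lt a ∪ upper lt a ⊆ support a := by
  rintro x (⟨y, hxy, h, -⟩ | ⟨y, hxy, h, -⟩)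
  · exact ⟨_, h, by simp [mkPair]⟩
  · exact ⟨_, h, by simp [mkPair]⟩

/-- If `h b ≤ h a`, then by (iii) the pairs of `[⋃ a]² \ a` have `h`-value above `h a`, so none lies
in `b`. -/
theorem oneSided_of_separates {lt : α → α → Prop} [IsStrictTotalOrder α lt] {h : s.Class → ℕ}
    (hs : ∀ a, Separates lt h a (lower lt a) (upper lt a)) : s.OneSided := by
  have key : ∀ a b : s.Class, h b ≤ h a →
      Disjoint (pairsIn (support a) \ members a) (members b) := by
    intro a b hab
    rw [Set.disjoint_left]
    rintro p ⟨hp, hpa⟩ hpb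
    obtain ⟨x, y, hxy, hp'⟩ := Finset.card_eq_two.mp p.2
    have hx : x ∈ p.1 := by simp [hp']
    have hy : y ∈ p.1 := by simp [hp']
    have hm := exists_eq_mkPair hxy hx hy
    have := (hs a).2.2 x y hxy (support_subset a (hp hx)) (support_subset a (hp hy)) (hm ▸ hpa)
    rw [← hm, show Quotient.mk s.e p = b from hpb] at this
    omega
  intro a b _
  rcases le_total (h b) (h a) with hab | hab
  · exact Or.inl (key a b hab)
  · exact Or.inr (key b a hab)

theorem separates_of_star_coloring [Finite α] {X : Type*} [LinearOrder X]
    {c : Finset X → ℕ × ℕ × ℕ}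
    (hc₁ : ∀ α β α' β' : X, α < β → α' < β' → c {α, β} = c {α', β'} → α ≠ β')
    (hc₂ : ∀ b b' : Finset X, b.card = 2 → b'.card = 2 → c b = c b' →
      ∀ u ∈ b, ∀ v ∈ b', u ≠ v → (c b).1 < (c {u, v}).1 ∨ {u, v} = b ∨ {u, v} = b')
    (g : α ↪ X) (hg : ∀ b d : Pair α, s.e.r b d → c (b.1.map g) = c (d.1.map g)) :
    ∃ h : s.Class → ℕ, ∀ a, Separates (fun x y => g x < g y) h a
      (lower (fun x y => g x < g y) a) (upper (fun x y => g x < g y) a) := by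
  have hmem : ∀ {a : s.Class} {b d : Pair α}, b ∈ members a → d ∈ members a →
      c (b.1.map g) = c (d.1.map g) := fun hb hd =>
    hg _ _ (Quotient.exact (Eq.trans hb (Eq.symm hd)))
  have hmap : ∀ {x y : α} (hxy : x ≠ y), (mkPair x y hxy).1.map g = {g x, g y} := fun hxy => by
    simp [mkPair]
  refine ⟨Quotient.lift (fun b => (c (b.1.map g)).1) fun b d h => congrArg Prod.fst (hg b d h),
    fun a => ⟨⟨Set.toFinite _, Set.toFinite _, ?_⟩, ?_, ?_⟩⟩
  · rw [Set.disjoint_left]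
    rintro x ⟨y, hxy, hm, hlt⟩ ⟨z, hzx, hm', hlt'⟩
    have := hmem hm hm'
    rw [hmap, hmap] at this
    exact hc₁ _ _ _ _ hlt hlt' this rfl
  · exact fun x y hxy hm hlt => ⟨⟨y, hxy, hm, hlt⟩, ⟨x, hxy, hm, hlt⟩⟩
  · intro x y hxy hx hy hm
    obtain ⟨b, hb, hxb⟩ := lower_union_upper_subset a hx
    obtain ⟨d, hd, hyd⟩ := lower_union_upper_subset a hy
    have hne : ∀ p ∈ members a, ({g x, g y} : Finset X) ≠ p.1.map g := by
      intro p hp he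
      rw [← hmap hxy] at he
      rw [Subtype.ext (Finset.map_injective g he)] at hm
      exact hm hp
    have hlt : (c (b.1.map g)).1 < (c ((mkPair x y hxy).1.map g)).1 := by
      rw [hmap hxy]
      refine (hc₂ _ _ ((b.1.card_map g).trans b.2) ((d.1.card_map g).trans d.2) (hmem hb hd)
        _ (Finset.mem_map_of_mem g hxb) _ (Finset.mem_map_of_mem g hyd)
        (g.injective.ne hxy)).resolve_right ?_
      rintro (h | h)
      · exact hne b hb h
      · exact hne d hd h
    obtain rfl : Quotient.mk s.e b = a := hb
    exact hlt

end TwoIdentity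

open TwoIdentity in
theorem exists_separates_of_arrow {α : Type*} [DecidableEq α] [Finite α] {s : TwoIdentity α}
    (hs : Arrow.{_, 0} (ℵ_ 1) ℵ₀ s.plus) :
    ∃ lt : α → α → Prop, IsStrictTotalOrder α lt ∧ ∃ h : s.Class → ℕ,
      ∀ a, Separates lt h a (lower lt a) (upper lt a) := by
  have hX : ∀ x : Set.Iio (ℵ_ 1 : Cardinal.{0}).ord, (Set.Iio x).Countable := by
    intro x
    have hx : (Set.Iio x.1).Countable := by
      have h1 : x.1.card ≤ ℵ₀ := by
        rw [← Order.lt_succ_iff, succ_aleph0]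
        exact lt_ord.mp x.2
      rw [← le_aleph0_iff_set_countable, mk_Iio_ordinal]
      exact lift_le_aleph0.mpr h1
    exact (hx.preimage Subtype.val_injective).mono fun y hy => hy
  obtain ⟨c, hc₁, hc₂⟩ := exists_star_coloring hX
  -- The arrow relation wants colours below `ω`, so the triples are encoded injectively.
  obtain ⟨i, hi⟩ : ∃ i : ℕ × ℕ × ℕ → Set.Iio (ℵ₀ : Cardinal.{0}).ord, Function.Injective i := by
    refine ⟨fun p => ⟨(Encodable.encode p : ℕ), ?_⟩, fun p q h => ?_⟩
    · rw [ord_aleph0]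
      exact Ordinal.natCast_lt_omega0 _
    · simpa using h
  obtain ⟨g, hg⟩ := hs fun b => i (c b)
  have hg' : ∀ b d : Pair α, s.e.r b d → c (b.1.map g) = c (d.1.map g) := fun b d h =>
    hi (hg b.1 d.1 (Or.inl ⟨b.2, d.2, h⟩))
  obtain ⟨h, hh⟩ := separates_of_star_coloring hc₁ hc₂ g hg'
  exact ⟨_, (RelEmbedding.preimage g (· < ·)).isStrictTotalOrder, h, hh⟩

/-! ### The identities `s_k` with `k ≥ 3`. -/

theorem sk_not_oneSided {k : ℕ} (hk : 3 ≤ k) : ¬ (sk k).OneSided := by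
  intro hs
  have hk2 : 3 ≤ k.choose 2 := Nat.choose_le_choose 2 hk
  let p : ∀ x y : ℕ, x < y → y < k + k.choose 2 → Pair (Fin (k + k.choose 2)) :=
    fun x y h hy => mkPair ⟨x, h.trans hy⟩ ⟨y, hy⟩ (by simpa using h.ne)
  have hp : ∀ x y h hy, (p x y h hy).1.map Fin.valEmbedding = {x, y} := by
    intro x y h hy
    simp [p, mkPair]
  -- The points `k` and `k + 2` code `(0, 1)` and `(1, 2)`. The high pair `{1, k}` lies in the union
  -- of the low pairs `{0, k}` and `{1, k + 2}`, and the low pair `{1, k + 2}` in the union of the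
  -- high pairs `{1, k}` and `{2, k + 2}`.
  let l₀ := p 0 k (by omega) (by omega)
  let l₁ := p 1 (k + 2) (by omega) (by omega)
  let u₀ := p 1 k (by omega) (by omega)
  let u₁ := p 2 (k + 2) (by omega) (by omega)
  have hl₀ : l₀ ∈ lowClass k := ⟨0, 1, by omega, by omega, by simp [l₀, hp]⟩
  have hl₁ : l₁ ∈ lowClass k := ⟨1, 2, by omega, by omega, by simp [l₁, hp]⟩
  have hu₀ : u₀ ∈ highClass k := ⟨0, 1, by omega, by omega, by simp [u₀, hp]⟩
  have hu₁ : u₁ ∈ highClass k := ⟨1, 2, by omega, by omega, by simp [u₁, hp]⟩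
  let a : (sk k).Class := Quotient.mk _ l₀
  let b : (sk k).Class := Quotient.mk _ u₀
  have ha : ∀ x ∈ lowClass k, x ∈ TwoIdentity.members a := fun x hx =>
    Quotient.sound (s := (sk k).e) (Or.inr (Or.inl ⟨hx, hl₀⟩))
  have hb : ∀ x ∈ highClass k, x ∈ TwoIdentity.members b := fun x hx =>
    Quotient.sound (s := (sk k).e) (Or.inr (Or.inr ⟨hx, hu₀⟩))
  have hab : a ≠ b := by
    intro h
    rcases Quotient.exact h with h | h | h
    · exact not_mem_highClass hl₀ (h ▸ hu₀)
    · exact not_mem_highClass h.2 hu₀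
    · exact not_mem_highClass hl₀ h.1
  have hsub : ∀ {A : Set (Fin (k + k.choose 2))} (x y h hy),
      (⟨x, h.trans hy⟩ : Fin (k + k.choose 2)) ∈ A → (⟨y, hy⟩ : Fin (k + k.choose 2)) ∈ A →
        p x y h hy ∈ pairsIn A := by
    intro A x y h hy hx hy' z hz
    have hz' : z ∈ ({⟨x, h.trans hy⟩, ⟨y, hy⟩} : Finset (Fin (k + k.choose 2))) := hz
    rcases Finset.mem_insert.mp hz' with rfl | hz'
    · exact hx
    · rwa [Finset.mem_singleton.mp hz']
  rcases hs a b hab with h | h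
  · refine Set.disjoint_left.mp h
      (show u₀ ∈ _ from ⟨hsub _ _ (by omega) (by omega) ?_ ?_, fun h' => ?_⟩) (hb _ hu₀)
    · exact ⟨l₁, ha _ hl₁, by simp [l₁, p, mkPair]⟩
    · exact ⟨l₀, ha _ hl₀, by simp [l₀, p, mkPair]⟩
    · exact hab (Eq.trans (Eq.symm h') (hb _ hu₀))
  · refine Set.disjoint_left.mp h
      (show l₁ ∈ _ from ⟨hsub _ _ (by omega) (by omega) ?_ ?_, fun h' => ?_⟩) (ha _ hl₁)
    · exact ⟨u₀, hb _ hu₀, by simp [u₀, p, mkPair]⟩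
    · exact ⟨u₁, hb _ hu₁, by simp [u₁, p, mkPair]⟩
    · exact hab (Eq.trans (Eq.symm (ha _ hl₁)) h')

end TwoId

theorem mainTheorem3 :
    (∀ s ∈ TwoId.ID₂.{0} (ℵ_ 1) ℵ₀,
      ∃ lt : Fin s.1 → Fin s.1 → Prop, IsStrictTotalOrder (Fin s.1) lt ∧
        ∃ h : s.2.Class → ℕ,
          (∀ a : s.2.Class, ∃ a₀ a₁ : Set (Fin s.1),
            TwoId.TwoIdentity.Separates lt h a a₀ a₁) ∧
          (∀ a : s.2.Class, TwoId.TwoIdentity.Separates lt h a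
            (TwoId.TwoIdentity.lower lt a) (TwoId.TwoIdentity.upper lt a)) ∧
          s.2.OneSided) ∧
    (∀ k : ℕ, 3 ≤ k →
      ¬ (TwoId.sk k).OneSided ∧
      (⟨k + k.choose 2, TwoId.sk k⟩ : Σ n : ℕ, TwoId.TwoIdentity (Fin n)) ∉
        TwoId.ID₂.{0} (ℵ_ 1) ℵ₀) := by
  refine ⟨fun s hs => ?_, fun k hk => ⟨TwoId.sk_not_oneSided hk, fun hs => ?_⟩⟩
  · obtain ⟨lt, hlt, h, hh⟩ := TwoId.exists_separates_of_arrow hs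
    exact ⟨lt, hlt, h, fun a => ⟨_, _, hh a⟩, hh, TwoId.TwoIdentity.oneSided_of_separates hh⟩
  · obtain ⟨lt, hlt, h, hh⟩ := TwoId.exists_separates_of_arrow hs
    exact TwoId.sk_not_oneSided hk (TwoId.TwoIdentity.oneSided_of_separates hh)
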